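/- Fix natural numbers $n$ (grid dimension) and $D$ (bond dimension). For $N=(N_1,\dots,N_n)$ with all $N_i\ge 1$, let $G(N)$ be the $n$-dimensional square grid of size $N_1\times\cdots\times N_n$: its vertices are the $v=(v_1,\dots,v_n)$ with $0\le v_i<N_i$, its inner edges join $v$ and $v+\mathbf e_i$ whenever both are vertices, and its set $E_O(G(N))$ of outgoing edges consists of the pairs $(v,\pm\mathbf e_i)$ for which $v$ is a vertex and $v\pm\mathbf e_i$ is not; so every vertex has degree $2n$. For tensors $T_v\in(\mathbb C^D)^{\otimes 2n}$ placed at the vertices, with one tensor factor for each of the directions $\pm\mathbf e_i$, let $\mathcal C[v\mapsto T_v]\in(\mathbb C^D)^{\otimes E_O(G(N))}$ be the tensor obtained by contracting along all inner edges. Let $\mathcal A=(A_1,\dots,A_d)$ be a tuple of tensors in $(\mathbb C^D)^{\otimes 2n}$. The grid $G(N)$ is an injective region for $\mathcal A$ if the tensors $\mathcal C[v\mapsto A_{i_v}]$, over all maps $v\mapsto i_v\in\{1,\dots,d\}$, span $(\mathbb C^D)^{\otimes E_O(G(N))}$; and $\mathcal A$ is injective if some grid $G(N)$ is an injective region for $\mathcal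 A$. **Corollary.** For all $n$ and $D$ there is an algorithm that decides whether a given tuple $\mathcal A$ of tensors in $(\mathbb C^D)^{\otimes 2n}$ is injective. More precisely, there is a program for a register machine over $\mathbb C$ in the style of Blum, Shub and Smale (natural-number registers with integer arithmetic and comparisons; complex registers, addressed indirectly by natural numbers, on which the only operations are $+$, $-$, $\times$ and the test for zero; integer constants only) such that for every $d$ and every $\mathcal A\in((\mathbb C^D)^{\otimes 2n})^d$, started with $d$ and the coordinates of $\mathcal A$ in its registers, the program halts after finitely many steps with output $1$ if $\mathcal A$ is injective and with output $0$ otherwise. -/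

import Mathlib

namespace PEPS

/-! ### Tensors and square grids -/

/-- The `2n` directions at a vertex of an `n`-dimensional grid:
`(i, true)` is `+eᵢ` and `(i, false)` is `-eᵢ`. -/
abbrev Direction (n : ℕ) : Type := Fin n × Bool

/-- The space `(ℂ^D)^{⊗ ι}` in coordinates with respect to the standard basis: a tensor has one
coefficient for every multi-index `ι → {0, …, D-1}`. -/
abbrev Tensor (D : ℕ) (ι : Type) : Type := (ι → Fin D) → ℂ

/-- The vertices of the `n`-dimensional square grid of size `N₁ × ⋯ × Nₙ`. -/
abbrev Vertex {n : ℕ} (N : Fin n → ℕ) : Type := ∀ i : Fin n, Fin (N i)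

/-- The outgoing edges `(v, ±eᵢ)`: directions pointing out of the grid at a boundary vertex `v`. -/
abbrev OutEdge {n : ℕ} (N : Fin n → ℕ) : Type :=
  { h : Vertex N × Direction n //
    if h.2.2 = true then (h.1 h.2.1 : ℕ) + 1 = N h.2.1 else (h.1 h.2.1 : ℕ) = 0 }

/-- The inner edges: the pair `(v, i)` stands for the edge that joins `v` and `v + eᵢ`. -/
abbrev InnerEdge {n : ℕ} (N : Fin n → ℕ) : Type :=
  { h : Vertex N × Fin n // (h.1 h.2 : ℕ) + 1 < N h.2 }

/-- The inner edge that joins `v - eᵢ` and `v`, when `v` is not on the lower boundary. -/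
def innerEdgeBelow {n : ℕ} {N : Fin n → ℕ} (v : Vertex N) (i : Fin n) (h : (v i : ℕ) ≠ 0) :
    InnerEdge N :=
  ⟨(Function.update v i ⟨(v i : ℕ) - 1, lt_of_le_of_lt (Nat.sub_le _ _) (v i).isLt⟩, i), by
    have h2 := (v i).isLt
    simp only [Function.update_self]
    omega⟩

/-- Given basis labels `o` on the outgoing and `x` on the inner edges, the multi-index seen by the
vertex `v`: the label of the edge that leaves `v` in each of the `2n` directions. -/
def labelsAt {n D : ℕ} {N : Fin n → ℕ} (o : OutEdge N → Fin D) (x : InnerEdge N → Fin D)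
    (v : Vertex N) : Direction n → Fin D
  | (i, true) =>
      if h : (v i : ℕ) + 1 = N i then o ⟨(v, (i, true)), by simpa using h⟩
      else x ⟨(v, i), by have h2 := (v i).isLt; show (v i : ℕ) + 1 < N i; omega⟩
  | (i, false) =>
      if h : (v i : ℕ) = 0 then o ⟨(v, (i, false)), by simpa using h⟩
      else x (innerEdgeBelow v i h)

/-- The tensor `𝒞[v ↦ T v]` on the outgoing edges, obtained by placing the tensor `T v` at every
vertex `v` and contracting along all inner edges. -/
noncomputable def contraction {n D : ℕ} (N : Fin n → ℕ) (T : Vertex N → Tensor D (Direction n)) :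
    Tensor D (OutEdge N) :=
  fun o => ∑ x : InnerEdge N → Fin D, ∏ v : Vertex N, T v (labelsAt o x v)

/-- The grid of size `N` is an injective region for `𝒜 = (A₁, …, A_d)`: the contractions, over all
ways of placing a tensor of `𝒜` at every vertex, span the whole space `(ℂ^D)^{⊗ E_O}`. -/
def IsInjectiveRegion {n D d : ℕ} (N : Fin n → ℕ) (A : Fin d → Tensor D (Direction n)) : Prop :=
  Submodule.span ℂ
    (Set.range fun c : Vertex N → Fin d => contraction N fun v => A (c v)) = ⊤

/-- `𝒜` is injective: some (nonempty) square grid is an injective region for `𝒜`. -/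
def IsInjective {n D d : ℕ} (A : Fin d → Tensor D (Direction n)) : Prop :=
  ∃ N : Fin n → ℕ, (∀ i, 0 < N i) ∧ IsInjectiveRegion N A

/-! ### Algorithms on complex numbers

Programs for a register machine over `ℂ` in the style of Blum, Shub and Smale. The machine has
index registers, which hold natural numbers, and data registers, which hold complex numbers and can
be addressed indirectly. On complex numbers it can only add, subtract, multiply and test for zero,
and the only constants in a program are integers. -/

/-- Arithmetic expressions in the index registers. -/
inductive IndexExpr : Type
  | const (k : ℕ)
  | reg (r : ℕ)
  | add (a b : IndexExpr)
  | sub (a b : IndexExpr)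
  | mul (a b : IndexExpr)
  | div (a b : IndexExpr)
  | mod (a b : IndexExpr)

/-- Ring expressions in the data registers; `load a` is the content of the data register whose
address is the value of `a`. -/
inductive DataExpr : Type
  | const (z : ℤ)
  | load (a : IndexExpr)
  | add (a b : DataExpr)
  | sub (a b : DataExpr)
  | mul (a b : DataExpr)

/-- The tests on which a program can branch. -/
inductive Test : Type
  | indexLt (a b : IndexExpr)
  | dataZero (e : DataExpr)

/-- Programs. -/
inductive Program : Type
  | nop
  | setIndex (r : ℕ) (a : IndexExpr)
  | store (a : IndexExpr) (e : DataExpr)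
  | seq (p q : Program)
  | branch (t : Test) (p q : Program)
  | loop (t : Test) (p : Program)

/-- The contents of all registers. -/
structure Memory : Type where
  index : ℕ → ℕ
  data : ℕ → ℂ

/-- Value of an index expression (truncated subtraction, integer division). -/
def IndexExpr.eval (m : Memory) : IndexExpr → ℕ
  | const k => k
  | reg r => m.index r
  | add a b => a.eval m + b.eval m
  | sub a b => a.eval m - b.eval m
  | mul a b => a.eval m * b.eval m
  | div a b => a.eval m / b.eval m
  | mod a b => a.eval m % b.eval m

/-- Value of a data expression. -/
noncomputable def DataExpr.eval (m : Memory) : DataExpr → ℂ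
  | const z => (z : ℂ)
  | load a => m.data (a.eval m)
  | add a b => a.eval m + b.eval m
  | sub a b => a.eval m - b.eval m
  | mul a b => a.eval m * b.eval m

/-- The condition expressed by a test. -/
def Test.Holds (m : Memory) : Test → Prop
  | indexLt a b => a.eval m < b.eval m
  | dataZero e => e.eval m = 0

/-- A configuration: the programs that are still to be executed, in order, and the memory. The
machine has halted when no program is left. -/
abbrev Config : Type := List Program × Memory

open Classical in
/-- One step of the machine. -/
noncomputable def step : Config → Config
  | ([], m) => ([], m)
  | (.nop :: k, m) => (k, m)
  | (.setIndex r a :: k, m) => (k, { m with index := Function.update m.index r (a.eval m) })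
  | (.store a e :: k, m) => (k, { m with data := Function.update m.data (a.eval m) (e.eval m) })
  | (.seq p q :: k, m) => (p :: q :: k, m)
  | (.branch t p q :: k, m) => if t.Holds m then (p :: k, m) else (q :: k, m)
  | (.loop t p :: k, m) => if t.Holds m then (p :: .loop t p :: k, m) else (k, m)

/-- Started on the memory `m`, the program `p` halts after finitely many steps, with memory `m'`. -/
def HaltsWith (p : Program) (m m' : Memory) : Prop :=
  ∃ t : ℕ, step^[t] ([p], m) = ([], m')

/-- The position of a multi-index in the list of the `D ^ (2n)` coordinates of a tensor. -/
def coordinate {n D : ℕ} (j : Direction n → Fin D) : Fin (D ^ (n * 2)) :=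
  finFunctionFinEquiv fun k =>
    j ((finProdFinEquiv.symm k).1, finTwoEquiv (finProdFinEquiv.symm k).2)

/-- The position of a coordinate of a `d`-tuple `𝒜` in the list of all its `d * D ^ (2n)`
coordinates: they are listed tensor by tensor. -/
def position {n D d : ℕ} (c : Fin d × (Direction n → Fin D)) : ℕ :=
  (c.1 : ℕ) * D ^ (n * 2) + (coordinate c.2 : ℕ)

/-- Different coordinates have different positions. -/
theorem position_injective {n D d : ℕ} :
    Function.Injective (position : Fin d × (Direction n → Fin D) → ℕ) := by
  rintro ⟨i, j⟩ ⟨i', j'⟩ h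
  have h1 : finProdFinEquiv (i, coordinate j) = finProdFinEquiv (i', coordinate j') := by
    ext
    simp only [position] at h
    simp only [finProdFinEquiv_apply_val]
    linarith [mul_comm (i : ℕ) (D ^ (n * 2)), mul_comm (i' : ℕ) (D ^ (n * 2))]
  obtain ⟨h2, h3⟩ := Prod.mk.inj (finProdFinEquiv.injective h1)
  have h4 := finFunctionFinEquiv.injective h3
  refine Prod.ext h2 (funext fun e => ?_)
  have h5 := congrFun h4 (finProdFinEquiv (e.1, finTwoEquiv.symm e.2))
  simpa using h5

/-- The initial memory on input `𝒜`: the index register `0` holds the number `d` of tensors, the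
data registers `0, 1, …, d * D ^ (2n) - 1` hold the coordinates of `𝒜`, and all others hold `0`. -/
noncomputable def inputMemory {n D d : ℕ} (A : Fin d → Tensor D (Direction n)) : Memory where
  index := Function.update (fun _ => 0) 0 d
  data := Function.extend position (fun c : Fin d × (Direction n → Fin D) => A c.1 c.2)
    fun _ => 0

/-- The program `p` decides the property `P` of finite tuples of tensors in `(ℂ^D)^{⊗ 2n}`: on
every input tuple, of any length, it halts, and then the index register `0` holds `1` if `P` is
true for the tuple, and `0` if it is false. -/
def Decides (n D : ℕ) (p : Program)
    (P : ∀ {d : ℕ}, (Fin d → Tensor D (Direction n)) → Prop) : Prop :=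
  ∀ (d : ℕ) (A : Fin d → Tensor D (Direction n)), ∃ m : Memory,
    HaltsWith p (inputMemory A) m ∧
      ((P A ∧ m.index 0 = 1) ∨ (¬ P A ∧ m.index 0 = 0))

end PEPS

namespace PEPS

/-! For a fixed number of tensors, a grid is an injective region exactly when some maximal minor of
its contractions is nonzero, and these minors are integer polynomials in the coordinates
(`aeval_regionDet`). The grids give infinitely many such polynomials, but by Hilbert's basis theorem
over `ℤ` finitely many generate the same ideal, and these suffice to test injectivity
(`exists_polynomials_isInjective_iff`). The finite list is not computed: it exists and is written
into the program.

One program must serve every `d`, while the list depends on `d`. Injectivity depends only on the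
span of the tuple, whose dimension is at most `M = D ^ (2n)`, so it is enough to test all selections
of `M` tensors with repetition (`isInjective_iff_exists_comp`). The program loops over these `d ^ M`
selections, using the one list for `M`. -/

/-! ### Linear algebra -/

/-- A family of vectors in `ℂ^κ` spans if and only if some choice of `κ` many of its members has
nonzero determinant. -/
theorem span_range_eq_top_iff_exists_det_ne_zero {ι κ : Type*} [Fintype κ] [DecidableEq κ]
    (v : ι → κ → ℂ) :
    Submodule.span ℂ (Set.range v) = ⊤ ↔
      ∃ e : κ → ι, (Matrix.of fun a b => v (e a) b).det ≠ 0 := by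
  constructor
  · intro h
    obtain ⟨κ', a, -, hspan, hli⟩ := exists_linearIndependent' ℂ v
    let b := Module.Basis.mk hli (by rw [hspan, h])
    -- The basis extracted from `v` has as many members as the standard basis, so it can be indexed
    -- by `κ`.
    let f : κ ≃ κ' := (Pi.basisFun ℂ κ).indexEquiv b
    refine ⟨a ∘ f, ?_⟩
    have h1 : LinearIndependent ℂ (Matrix.of fun i j => v ((a ∘ f) i) j).row :=
      hli.comp f f.injective
    rw [Matrix.linearIndependent_rows_iff_isUnit, Matrix.isUnit_iff_isUnit_det] at h1
    exact h1.ne_zero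
  · rintro ⟨e, he⟩
    have h1 : LinearIndependent ℂ (Matrix.of fun a b => v (e a) b).row := by
      rw [Matrix.linearIndependent_rows_iff_isUnit, Matrix.isUnit_iff_isUnit_det]
      exact he.isUnit
    have h2 : Submodule.span ℂ (Set.range (v ∘ e)) = ⊤ :=
      LinearIndependent.span_eq_top_of_card_eq_finrank' (b := v ∘ e) h1 (by simp)
    exact top_le_iff.mp (h2 ▸ Submodule.span_mono (Set.range_comp_subset_range e v))

/-- The contraction as a multilinear map of the tensors at the vertices. -/
noncomputable def contractionMultilinear {n D : ℕ} (N : Fin n → ℕ) :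
    MultilinearMap ℂ (fun _ : Vertex N => Tensor D (Direction n)) (Tensor D (OutEdge N)) :=
  MultilinearMap.pi fun o => ∑ x : InnerEdge N → Fin D,
    (MultilinearMap.mkPiAlgebra ℂ (Vertex N) ℂ).compLinearMap
      fun v => LinearMap.proj (labelsAt o x v)

theorem contractionMultilinear_apply {n D : ℕ} (N : Fin n → ℕ)
    (T : Vertex N → Tensor D (Direction n)) :
    contractionMultilinear N T = contraction N T := by
  ext o
  simp [contractionMultilinear, contraction]

variable {n D d d' : ℕ}

/-- An injective region of a tuple is injective for every tuple whose span contains the first. -/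
theorem IsInjectiveRegion.of_mem_span {N : Fin n → ℕ} {A : Fin d → Tensor D (Direction n)}
    {B : Fin d' → Tensor D (Direction n)} (hA : IsInjectiveRegion N A)
    (h : ∀ i, A i ∈ Submodule.span ℂ (Set.range B)) : IsInjectiveRegion N B := by
  refine top_le_iff.mp (hA ▸ Submodule.span_le.mpr ?_)
  rintro _ ⟨c, rfl⟩
  choose g hg using fun i => (Submodule.mem_span_range_iff_exists_fun ℂ).mp (h i)
  have h1 : (fun v : Vertex N => A (c v)) = fun v => ∑ j, g (c v) j • B j :=
    funext fun v => (hg (c v)).symm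
  change contraction N _ ∈ _
  -- By multilinearity the contraction becomes a combination of contractions of tensors of `B`, one
  -- for each placement `r`.
  rw [h1, ← contractionMultilinear_apply, MultilinearMap.map_sum]
  refine Submodule.sum_mem _ fun r _ => ?_
  rw [MultilinearMap.map_smul_univ (contractionMultilinear N) (fun v => g (c v) (r v))
    fun v => B (r v)]
  exact Submodule.smul_mem _ _
    (Submodule.subset_span ⟨r, (contractionMultilinear_apply N _).symm⟩)

/-- The empty tuple can be injective only if the tensor spaces vanish. -/
theorem IsInjective.isEmpty_labels {A : Fin 0 → Tensor D (Direction n)} (hA : IsInjective A) :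
    IsEmpty (Direction n → Fin D) := by
  obtain ⟨N, hN, h⟩ := hA
  refine ⟨fun j => ?_⟩
  have h1 : IsEmpty (Vertex N → Fin 0) := ⟨fun c => (c fun i => ⟨0, hN i⟩).elim0⟩
  rw [IsInjectiveRegion, Set.range_eq_empty, Submodule.span_empty] at h
  -- Without placements the span is zero, yet it contains the constant tensor 1. Repeating `j` at
  -- every vertex gives a multi-index at which to read off `1 = 0`.
  have h2 : (fun _ => 1 : Tensor D (OutEdge N)) ∈ (⊥ : Submodule ℂ _) := h ▸ Submodule.mem_top
  simpa using congrFun ((Submodule.mem_bot ℂ).mp h2) fun e => j e.1.2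

/-- A tuple is injective if and only if one can select from it, with repetitions, as many tensors
as the dimension of the tensor space so that the selected tuple is injective. -/
theorem isInjective_iff_exists_comp (A : Fin d → Tensor D (Direction n)) :
    IsInjective A ↔
      ∃ s : Fin (Fintype.card (Direction n → Fin D)) → Fin d, IsInjective (A ∘ s) := by
  constructor
  · intro hA
    obtain ⟨κ, a, ha, hspan, hli⟩ := exists_linearIndependent' ℂ A
    have : Fintype κ := Fintype.ofInjective a ha
    have hcard : Fintype.card κ ≤ Fintype.card (Fin (Fintype.card (Direction n → Fin D))) := by
      simpa using hli.fintype_card_le_finrank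
    obtain ⟨f⟩ := Function.Embedding.nonempty_of_card_le hcard
    obtain ⟨s, hs⟩ : ∃ s : Fin (Fintype.card (Direction n → Fin D)) → Fin d, s ∘ f = a := by
      -- Extending `a` to all of `Fin M` needs a default tensor. For `d = 0` there is none, but then
      -- injectivity forces `M = 0`.
      rcases d with _ | d
      · have := hA.isEmpty_labels
        have : IsEmpty (Fin (Fintype.card (Direction n → Fin D))) := by
          rw [Fintype.card_eq_zero]; infer_instance
        exact ⟨isEmptyElim, funext fun k => (this.false (f k)).elim⟩
      · exact ⟨Function.extend f a fun _ => 0, funext fun k => f.injective.extend_apply _ _ k⟩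
    obtain ⟨N, hN, h⟩ := hA
    refine ⟨s, N, hN, h.of_mem_span fun i => ?_⟩
    have h1 : A i ∈ Submodule.span ℂ (Set.range (A ∘ a)) :=
      hspan ▸ Submodule.subset_span ⟨i, rfl⟩
    exact Submodule.span_mono (by rw [← hs]; exact Set.range_comp_subset_range f (A ∘ s)) h1
  · rintro ⟨s, N, hN, h⟩
    exact ⟨N, hN, h.of_mem_span fun i => Submodule.subset_span ⟨s i, rfl⟩⟩

/-! ### Injectivity is the nonvanishing of finitely many integer polynomials -/

/-- The generic determinant: `e` selects as many placements of generic tensors on the grid as the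
space of tensors on the outgoing edges has dimensions. -/
noncomputable def regionDet (d : ℕ) (N : Fin n → ℕ)
    (e : (OutEdge N → Fin D) → Vertex N → Fin d) :
    MvPolynomial (Fin d × (Direction n → Fin D)) ℤ :=
  (Matrix.of fun a b : OutEdge N → Fin D => ∑ x : InnerEdge N → Fin D,
    ∏ v : Vertex N, MvPolynomial.X (e a v, labelsAt b x v)).det

theorem aeval_regionDet (A : Fin d → Tensor D (Direction n)) (N : Fin n → ℕ)
    (e : (OutEdge N → Fin D) → Vertex N → Fin d) :
    MvPolynomial.aeval (fun c => A c.1 c.2) (regionDet d N e) =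
      (Matrix.of fun a b : OutEdge N → Fin D => contraction N (fun v => A (e a v)) b).det := by
  rw [regionDet, AlgHom.map_det]
  congr 1
  ext a b
  simp [contraction]

theorem isInjective_iff_exists_aeval_regionDet_ne_zero (A : Fin d → Tensor D (Direction n)) :
    IsInjective A ↔ ∃ N : Fin n → ℕ, (∀ i, 0 < N i) ∧
      ∃ e, MvPolynomial.aeval (fun c => A c.1 c.2) (regionDet d N e) ≠ 0 := by
  simp only [IsInjective, IsInjectiveRegion, span_range_eq_top_iff_exists_det_ne_zero,
    aeval_regionDet]

/-- For tuples of fixed length, finitely many polynomials with integer coefficients decide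
injectivity, by Hilbert's basis theorem. -/
theorem exists_polynomials_isInjective_iff (n D d : ℕ) :
    ∃ S : List (MvPolynomial (Fin d × (Direction n → Fin D)) ℤ),
      ∀ A : Fin d → Tensor D (Direction n),
        IsInjective A ↔ ∃ f ∈ S, MvPolynomial.aeval (fun c => A c.1 c.2) f ≠ 0 := by
  let R := { f : MvPolynomial (Fin d × (Direction n → Fin D)) ℤ |
    ∃ N : Fin n → ℕ, (∀ i, 0 < N i) ∧ ∃ e, regionDet d N e = f }
  obtain ⟨S, hS⟩ := IsNoetherian.noetherian (Ideal.span R)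
  refine ⟨S.toList, fun A => ?_⟩
  let φ : MvPolynomial (Fin d × (Direction n → Fin D)) ℤ →+* ℂ :=
    (MvPolynomial.aeval fun c => A c.1 c.2).toRingHom
  -- The kernel of evaluation is an ideal, so it contains `R` if and only if it contains the finite
  -- generating set `S`.
  have key : (∀ f ∈ R, φ f = 0) ↔ ∀ f ∈ S, φ f = 0 := by
    have h1 : Ideal.span R ≤ RingHom.ker φ ↔ Ideal.span (S : Set _) ≤ RingHom.ker φ := by
      rw [← hS]
    rw [Ideal.span_le, Ideal.span_le] at h1
    exact h1
  rw [isInjective_iff_exists_aeval_regionDet_ne_zero, ← not_iff_not]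
  push Not
  simp only [Finset.mem_toList]
  refine Iff.trans ⟨?_, ?_⟩ key
  · rintro h _ ⟨N, hN, e, rfl⟩
    exact h N hN e
  · exact fun h N hN e => h _ ⟨N, hN, e, rfl⟩

/-! ### Programs -/

/-- Started on the memory `m`, the program `p` terminates with memory `m'`, whatever remains to be
executed afterwards. -/
def Runs (p : Program) (m m' : Memory) : Prop :=
  ∃ t : ℕ, ∀ k : List Program, step^[t] (p :: k, m) = (k, m')

theorem Runs.haltsWith {p : Program} {m m' : Memory} (h : Runs p m m') : HaltsWith p m m' :=
  h.imp fun _ ht => ht []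

theorem Runs.nop (m : Memory) : Runs .nop m m := ⟨1, fun _ => rfl⟩

theorem Runs.setIndex (r : ℕ) (a : IndexExpr) (m : Memory) :
    Runs (.setIndex r a) m { m with index := Function.update m.index r (a.eval m) } :=
  ⟨1, fun _ => rfl⟩

/-- The arbitrary continuation in `Runs` is what allows composition: `p` is run with `q :: k` still
pending. The extra step unfolds `seq`. -/
theorem Runs.seq {p q : Program} {m m' m'' : Memory} (hp : Runs p m m') (hq : Runs q m' m'') :
    Runs (.seq p q) m m'' := by
  obtain ⟨s, hs⟩ := hp
  obtain ⟨t, ht⟩ := hq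
  refine ⟨t + (s + 1), fun k => ?_⟩
  rw [Function.iterate_add_apply, Function.iterate_succ_apply, step, hs, ht]

theorem Runs.branch_pos {c : Test} {p q : Program} {m m' : Memory} (hc : c.Holds m)
    (hp : Runs p m m') : Runs (.branch c p q) m m' := by
  obtain ⟨s, hs⟩ := hp
  refine ⟨s + 1, fun k => ?_⟩
  rw [Function.iterate_succ_apply, step, if_pos hc, hs]

theorem Runs.branch_neg {c : Test} {p q : Program} {m m' : Memory} (hc : ¬ c.Holds m)
    (hq : Runs q m m') : Runs (.branch c p q) m m' := by
  obtain ⟨s, hs⟩ := hq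
  refine ⟨s + 1, fun k => ?_⟩
  rw [Function.iterate_succ_apply, step, if_neg hc, hs]

theorem Runs.loop_neg {c : Test} {p : Program} {m : Memory} (hc : ¬ c.Holds m) :
    Runs (.loop c p) m m := by
  refine ⟨1, fun k => ?_⟩
  rw [Function.iterate_one, step, if_neg hc]

theorem Runs.loop_pos {c : Test} {p : Program} {m m' m'' : Memory} (hc : c.Holds m)
    (hp : Runs p m m') (hl : Runs (.loop c p) m' m'') : Runs (.loop c p) m m'' := by
  obtain ⟨s, hs⟩ := hp
  obtain ⟨t, ht⟩ := hl
  refine ⟨t + (s + 1), fun k => ?_⟩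
  rw [Function.iterate_add_apply, Function.iterate_succ_apply, step, if_pos hc, hs, ht]

/-- Integer polynomials in data registers are expressions. -/
theorem exists_dataExpr_eval_eq_aeval {σ : Type*} (v : σ → IndexExpr) (f : MvPolynomial σ ℤ) :
    ∃ e : DataExpr, ∀ m : Memory,
      e.eval m = MvPolynomial.aeval (fun i => m.data ((v i).eval m)) f := by
  induction f using MvPolynomial.induction_on with
  | C z => exact ⟨.const z, fun m => by simp [DataExpr.eval]⟩
  | add p q hp hq =>
    obtain ⟨e, he⟩ := hp
    obtain ⟨e', he'⟩ := hq
    exact ⟨.add e e', fun m => by rw [DataExpr.eval, he, he', map_add]⟩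
  | mul_X p i hp =>
    obtain ⟨e, he⟩ := hp
    exact ⟨.mul e (.load (v i)), fun m => by simp [DataExpr.eval, he]⟩

/-- The power of an index expression with a constant exponent. -/
def IndexExpr.pow (a : IndexExpr) : ℕ → IndexExpr
  | 0 => .const 1
  | k + 1 => .mul (a.pow k) a

theorem IndexExpr.eval_pow (m : Memory) (a : IndexExpr) (k : ℕ) :
    (a.pow k).eval m = a.eval m ^ k := by
  induction k with
  | zero => rfl
  | succ k ih => rw [IndexExpr.pow, IndexExpr.eval, ih, pow_succ]

/-- Sets the index register `2` to `1` if one of the given expressions does not vanish. -/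
def anyNonzero : List DataExpr → Program
  | [] => .nop
  | e :: l => .seq (anyNonzero l) (.branch (.dataZero e) .nop (.setIndex 2 (.const 1)))

/-- The memory at a stage of the search: the number of tensors, the counter and the answer are in
the first three index registers. -/
def searchMemory (d k r : ℕ) (x : ℕ → ℂ) : Memory where
  index := Function.update (Function.update (Function.update (fun _ => 0) 2 r) 1 k) 0 d
  data := x

theorem runs_setAnswer (d k r : ℕ) (x : ℕ → ℂ) :
    Runs (.setIndex 2 (.const 1)) (searchMemory d k r x) (searchMemory d k 1 x) := by
  convert Runs.setIndex _ _ _ using 1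
  simp only [searchMemory, IndexExpr.eval, Memory.mk.injEq, and_true]
  funext i
  by_cases h0 : i = 0 <;> by_cases h1 : i = 1 <;> by_cases h2 : i = 2 <;>
    simp_all

theorem runs_incrementCounter (d k r : ℕ) (x : ℕ → ℂ) :
    Runs (.setIndex 1 (.add (.reg 1) (.const 1))) (searchMemory d k r x)
      (searchMemory d (k + 1) r x) := by
  convert Runs.setIndex _ _ _ using 1
  simp only [searchMemory, IndexExpr.eval, Memory.mk.injEq, and_true]
  funext i
  by_cases h0 : i = 0 <;> by_cases h1 : i = 1 <;> by_cases h2 : i = 2 <;>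
    simp_all

-- The answer register may change during the pass, so `hl` asks that the tested values not depend on
-- it; the outcome can then be stated with answer `0`.
open Classical in
theorem runs_anyNonzero (l : List DataExpr) (d k r : ℕ) (x : ℕ → ℂ)
    (hl : ∀ e ∈ l, ∀ r r', e.eval (searchMemory d k r x) = e.eval (searchMemory d k r' x)) :
    Runs (anyNonzero l) (searchMemory d k r x)
      (searchMemory d k (if ∃ e ∈ l, e.eval (searchMemory d k 0 x) ≠ 0 then 1 else r) x) := by
  induction l with
  | nil => simpa [anyNonzero] using Runs.nop _
  | cons e l ih =>
    refine (ih fun e he => hl e (List.mem_cons_of_mem _ he)).seq ?_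
    have he (r : ℕ) := hl e List.mem_cons_self r 0
    by_cases h : e.eval (searchMemory d k 0 x) = 0
    · refine Runs.branch_pos ((he _).trans h) ?_
      simpa [h] using Runs.nop _
    · refine Runs.branch_neg (fun h' => h ((he _).symm.trans h')) ?_
      simpa [h] using runs_setAnswer d k _ x

open Classical in
/-- A bounded search: if one pass of `p` turns the answer into `1` exactly when the counter has the
property `Q`, then the loop finds out whether some counter below the bound has it. -/
theorem runs_search {p : Program} {b : IndexExpr} {d B : ℕ} {x : ℕ → ℂ} {Q : ℕ → Prop}
    (hb : ∀ k r, b.eval (searchMemory d k r x) = B)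
    (hp : ∀ k < B, ∀ r, Runs p (searchMemory d k r x)
      (searchMemory d k (if Q k then 1 else r) x)) :
    Runs (.loop (.indexLt (.reg 1) b) (.seq p (.setIndex 1 (.add (.reg 1) (.const 1)))))
      (searchMemory d 0 0 x) (searchMemory d B (if ∃ i < B, Q i then 1 else 0) x) := by
  have holds (k r : ℕ) : (Test.indexLt (.reg 1) b).Holds (searchMemory d k r x) ↔ k < B := by
    rw [Test.Holds, hb]
    simp [IndexExpr.eval, searchMemory]
  -- Induction on the number `j` of remaining rounds. The invariant is that the answer records
  -- whether `Q` holds somewhere below the counter `k`.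
  have main (j : ℕ) : ∀ k, k + j = B →
      Runs (.loop (.indexLt (.reg 1) b) (.seq p (.setIndex 1 (.add (.reg 1) (.const 1)))))
        (searchMemory d k (if ∃ i < k, Q i then 1 else 0) x)
        (searchMemory d B (if ∃ i < B, Q i then 1 else 0) x) := by
    induction j with
    | zero =>
      rintro k rfl
      exact Runs.loop_neg ((holds _ _).not.mpr (lt_irrefl _))
    | succ j ih =>
      intro k hk
      have hk' : k < B := by omega
      refine Runs.loop_pos ((holds _ _).mpr hk')
        ((hp k hk' _).seq (runs_incrementCounter d k _ x)) ?_
      have h1 : (if Q k then 1 else if ∃ i < k, Q i then 1 else 0) =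
          if ∃ i < k + 1, Q i then 1 else 0 := by
        simp only [Nat.exists_lt_succ_right]
        by_cases h : Q k <;> simp [h]
      rw [h1]
      exact ih (k + 1) (by omega)
  simpa using main B 0 (by omega)

/-- Counter and answer are already `0` on input, so the search needs no initialisation. -/
theorem inputMemory_eq_searchMemory (A : Fin d → Tensor D (Direction n)) :
    inputMemory A = searchMemory d 0 0 (inputMemory A).data := by
  simp [inputMemory, searchMemory]

/-- The address of a coordinate of the `j`-th selected tensor, when the counter encodes the
selection in base `d`. -/
def selectedAddress {M : ℕ} (c : Fin M × (Direction n → Fin D)) : IndexExpr :=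
  .add (.mul (.mod (.div (.reg 1) (.pow (.reg 0) c.1)) (.reg 0)) (.const (D ^ (n * 2))))
    (.const (coordinate c.2))

/-- The base-`d` digit of `k` at place `j` is `k / d ^ j % d`, which is also how
`finFunctionFinEquiv.symm` decodes `k`. -/
theorem eval_selectedAddress {M : ℕ} (k : Fin (d ^ M)) (r : ℕ) (x : ℕ → ℂ)
    (c : Fin M × (Direction n → Fin D)) :
    (selectedAddress c).eval (searchMemory d k r x) =
      position (finFunctionFinEquiv.symm k c.1, c.2) := by
  simp [selectedAddress, IndexExpr.eval, IndexExpr.eval_pow, searchMemory, position]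

theorem inputMemory_data_position (A : Fin d → Tensor D (Direction n))
    (c : Fin d × (Direction n → Fin D)) : (inputMemory A).data (position c) = A c.1 c.2 :=
  position_injective.extend_apply (fun c : Fin d × (Direction n → Fin D) => A c.1 c.2) (fun _ => 0) c

/-- Injectivity of tuples of tensors is decidable by a machine over the complex numbers. -/
theorem exists_decides_isInjective (n D : ℕ) :
    ∃ p : Program, Decides n D p (fun A => IsInjective A) := by
  let M := Fintype.card (Direction n → Fin D)
  obtain ⟨S, hS⟩ := exists_polynomials_isInjective_iff n D M
  choose E hE using exists_dataExpr_eval_eq_aeval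
    (selectedAddress : Fin M × (Direction n → Fin D) → IndexExpr)
  refine ⟨.seq (.loop (.indexLt (.reg 1) (.pow (.reg 0) M))
    (.seq (anyNonzero (S.map E)) (.setIndex 1 (.add (.reg 1) (.const 1)))))
    (.setIndex 0 (.reg 2)), fun d A => ?_⟩
  let x := (inputMemory A).data
  -- The addresses use only index registers `0` and `1`, so the value is independent of the answer
  -- `r`.
  have hE' (k : Fin (d ^ M)) (r : ℕ) (f : MvPolynomial (Fin M × (Direction n → Fin D)) ℤ) :
      (E f).eval (searchMemory d k r x) =
        MvPolynomial.aeval (fun c => (A ∘ finFunctionFinEquiv.symm k) c.1 c.2) f := by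
    rw [hE]
    simp only [eval_selectedAddress]
    congr 2
    funext c
    exact inputMemory_data_position A _
  let Q (k : ℕ) : Prop := ∃ e ∈ S.map E, e.eval (searchMemory d k 0 x) ≠ 0
  have hQ : (∃ k < d ^ M, Q k) ↔ IsInjective A := by
    -- Counters below `d ^ M` correspond to selections. This includes `d = 0`, where `0 ^ 0 = 1`
    -- accounts for the empty selection when `M = 0`.
    rw [isInjective_iff_exists_comp, ← finFunctionFinEquiv.symm.exists_congr_right, Fin.exists_iff]
    simp only [hS, Q, List.mem_map, exists_exists_and_eq_and]
    refine exists_congr fun k => ⟨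
      fun ⟨hk, f, hf, h⟩ => ⟨hk, f, hf, ?_⟩, fun ⟨hk, f, hf, h⟩ => ⟨hk, f, hf, ?_⟩⟩
    · exact (hE' ⟨k, hk⟩ 0 f).symm.trans_ne h
    · exact (hE' ⟨k, hk⟩ 0 f).trans_ne h
  have hrun := (runs_search (Q := Q) (fun k r => by
      simp [IndexExpr.eval_pow, IndexExpr.eval, searchMemory] :
        ∀ k r, (IndexExpr.pow (.reg 0) M).eval (searchMemory d k r x) = d ^ M)
      fun k hk r => by
        convert runs_anyNonzero (S.map E) d k r x fun e he r r' => ?_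
        obtain ⟨f, -, rfl⟩ := List.mem_map.mp he
        exact (hE' ⟨k, hk⟩ r f).trans (hE' ⟨k, hk⟩ r' f).symm).seq
    (Runs.setIndex 0 (.reg 2) _)
  rw [← inputMemory_eq_searchMemory] at hrun
  refine ⟨_, hrun.haltsWith, ?_⟩
  by_cases h : IsInjective A <;> simp [hQ, h, IndexExpr.eval, searchMemory]

end PEPS

theorem mainTheorem4 (n D : ℕ) :
    ∃ p : PEPS.Program, PEPS.Decides n D p (fun A => PEPS.IsInjective A) :=
  PEPS.exists_decides_isInjective n D
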